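/- **Theorem (Kalton).** Let $X$ be a real Banach sequence space, i.e. a Banach space of real sequences $(\xi_n)_{n\ge 1}$ which contains every unit vector $e_n$ and in which $\eta\in X$, $|\xi_n|\le|\eta_n|$ for all $n$ imply $\xi\in X$ and $\|\xi\|_X\le\|\eta\|_X$. Suppose that $\inf_n\|e_n\|_X>0$ and that, for some $1<p<q<\infty$, $X$ is $p$-convex and $q$-concave; that is, there is a constant $K\ge 1$ such that for all finite families $x_1,\dots,x_m\in X$ $$\Big\|\Big(\sum_{j=1}^m|x_j|^p\Big)^{1/p}\Big\|_X\le K\Big(\sum_{j=1}^m\|x_j\|_X^p\Big)^{1/p},\qquad \Big(\sum_{j=1}^m\|x_j\|_X^q\Big)^{1/q}\le K\Big\|\Big(\sum_{j=1}^m|x_j|^q\Big)^{1/q}\Big\|_X .$$ For integers $k\ge1$ and $0\le j<k$ let $L_k^j$ be the linear map with $L_k^j(e_n)=e_{kn+j}$ for all $n\ge1$, and suppose that there are real constants $C$ and $a$ with $a+\frac1p<1$ and $$\max_{0\le j<k}\|L_k^j\|_{X\to X}\le Ck^a\qquad(k\ge1).$$ Let $\Pi$ be the group of all permutations of $\{1,2,\dots\}$,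 put $S_\sigma\xi=(\xi_{\sigma(n)})_{n\ge1}$ for $\sigma\in\Pi$, and let $c_{00}$ be the space of finitely supported real sequences. Then $$\|\xi\|_{X_{\inf}}=\inf_{\sigma\in\Pi}\|S_\sigma\xi\|_X,\qquad \xi\in c_{00},$$ is a quasi-norm on $c_{00}$, and it is equivalent to a norm on $c_{00}$. Regard $X^*$ as a space of sequences by identifying $\varphi\in X^*$ with $(\varphi(e_n))_{n\ge1}$, and let $X^*_{\sup}$ be the space of all real sequences $\eta$ such that $S_\sigma\eta\in X^*$ for every $\sigma\in\Pi$ and $$\|\eta\|_{X^*_{\sup}}=\sup_{\sigma\in\Pi}\|S_\sigma\eta\|_{X^*}<\infty .$$ Then the dual of $X_{\inf}=(c_{00},\|\cdot\|_{X_{\inf}})$ is $X^*_{\sup}$: the linear map which sends $\eta$ to the functional $\xi\mapsto\sum_n\xi_n\eta_n$ is a bijection from $X^*_{\sup}$ onto the space of all linear functionals on $c_{00}$ that are bounded with respect to $\|\cdot\|_{X_{\inf}}$, and the norm $\inf\{M\ge 0:\ |f(\xi)|\le M\|\xi\|_{X_{\inf}}\text{ for all }\xi\in c_{00}\}$ of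 the functional $f$ given by $\eta$ equals $\|\eta\|_{X^*_{\sup}}$. -/

import Mathlib

/-- Finitely supported real sequences `c₀₀`, indexed by `1, 2, 3, …`. -/
abbrev C00 : Type := ℕ+ →₀ ℝ

/-- The structure of a Banach sequence space on a (complete, real) normed space `X`: `X` is
identified, through the injective linear map `coord`, with a linear space of real sequences which
contains every unit vector `e n` and is solid with a monotone norm. -/
structure BanachSeqSpace (X : Type*) [NormedAddCommGroup X] [NormedSpace ℝ X] where
  /-- the sequence of coordinates of a vector -/
  coord : X →ₗ[ℝ] (ℕ+ → ℝ)
  coord_injective : Function.Injective coord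
  /-- the unit vectors -/
  e : ℕ+ → X
  coord_e : ∀ n, coord (e n) = Pi.single n 1
  solid : ∀ (x : X) (ξ : ℕ+ → ℝ), (∀ n, |ξ n| ≤ |coord x n|) → ∃ y, coord y = ξ ∧ ‖y‖ ≤ ‖x‖

/-- The permutation operator `(S_σ ξ)(n) = ξ (σ n)` on `c₀₀`. -/
noncomputable def permC00 (σ : Equiv.Perm ℕ+) : C00 →ₗ[ℝ] C00 :=
  (Finsupp.domLCongr σ.symm).toLinearMap

theorem permC00_apply (σ : Equiv.Perm ℕ+) (ξ : C00) (n : ℕ+) : permC00 σ ξ n = ξ (σ n) := by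
  simp [permC00]

/-- The index map `n ↦ k n + j`. -/
def spreadIndex (k : ℕ+) (j : ℕ) (n : ℕ+) : ℕ+ :=
  ⟨k * n + j, Nat.add_pos_left (Nat.mul_pos k.pos n.pos) j⟩

/-- The linear map `L_k^j` on `c₀₀` with `L_k^j e_n = e_{kn+j}`. -/
noncomputable def spread (k : ℕ+) (j : ℕ) : C00 →ₗ[ℝ] C00 :=
  Finsupp.lmapDomain ℝ ℝ (spreadIndex k j)

theorem spread_single (k : ℕ+) (j : ℕ) (n : ℕ+) (c : ℝ) :
    spread k j (Finsupp.single n c) = Finsupp.single (spreadIndex k j n) c := by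
  simp [spread]

namespace BanachSeqSpace

variable {X : Type*} [NormedAddCommGroup X] [NormedSpace ℝ X]

/-- The inclusion of `c₀₀` in `X`. -/
noncomputable def ofC00 (S : BanachSeqSpace X) : C00 →ₗ[ℝ] X :=
  Finsupp.linearCombination ℝ S.e

theorem coord_ofC00 (S : BanachSeqSpace X) (ξ : C00) : S.coord (S.ofC00 ξ) = ξ := by
  induction ξ using Finsupp.induction_linear with
  | zero => simp
  | add f g hf hg => simp [hf, hg]
  | single n c =>
    ext m
    simp [ofC00, S.coord_e, Pi.single_apply, Finsupp.single_apply, eq_comm]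

theorem sum_rpow_le {m : ℕ} (a : Fin m → ℝ) (ha : ∀ j, 0 ≤ a j) {p : ℝ} (hp : 1 ≤ p) :
    ∑ j, a j ^ p ≤ (∑ j, a j) ^ p := by
  have h : ∀ s : Finset (Fin m), ∑ j ∈ s, a j ^ p ≤ (∑ j ∈ s, a j) ^ p := fun s => by
    induction s using Finset.induction_on with
    | empty => simp [Real.zero_rpow (by linarith : p ≠ 0)]
    | insert i s hi ih =>
      rw [Finset.sum_insert hi, Finset.sum_insert hi]
      exact (add_le_add le_rfl ih).trans
        (Real.add_rpow_le_rpow_add (ha i) (Finset.sum_nonneg fun j _ => ha j) hp)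
  exact h Finset.univ

/-- The vector `(∑ |x_j|^p)^{1/p}`, computed coordinatewise, belongs to the space. -/
theorem exists_pSum (S : BanachSeqSpace X) {p : ℝ} (hp : 1 ≤ p) {m : ℕ} (x : Fin m → X) :
    ∃ y : X, ∀ n, S.coord y n = (∑ j, |S.coord (x j) n| ^ p) ^ (1 / p) := by
  have h : ∀ j, ∃ z : X, S.coord z = fun n => |S.coord (x j) n| := fun j => by
    obtain ⟨z, hz, -⟩ := S.solid (x j) (fun n => |S.coord (x j) n|) (by simp)
    exact ⟨z, hz⟩
  choose z hz using h
  have hp0 : 0 < p := by linarith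
  obtain ⟨y, hy, -⟩ := S.solid (∑ j, z j)
    (fun n => (∑ j, |S.coord (x j) n| ^ p) ^ (1 / p)) (fun n => by
      have h0 : 0 ≤ ∑ j, |S.coord (x j) n| ^ p :=
        Finset.sum_nonneg fun j _ => Real.rpow_nonneg (abs_nonneg _) _
      have h1 : 0 ≤ ∑ j, |S.coord (x j) n| := Finset.sum_nonneg fun j _ => abs_nonneg _
      have h2 : S.coord (∑ j, z j) n = ∑ j, |S.coord (x j) n| := by
        simp [map_sum, Finset.sum_apply, hz]
      rw [h2, abs_of_nonneg (Real.rpow_nonneg h0 _), abs_of_nonneg h1]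
      calc (∑ j, |S.coord (x j) n| ^ p) ^ (1 / p)
          ≤ ((∑ j, |S.coord (x j) n|) ^ p) ^ (1 / p) :=
            Real.rpow_le_rpow h0 (sum_rpow_le _ (fun j => abs_nonneg _) hp) (by positivity)
        _ = ∑ j, |S.coord (x j) n| := by
            rw [← Real.rpow_mul h1, mul_one_div_cancel hp0.ne', Real.rpow_one])
  exact ⟨y, fun n => by rw [hy]⟩

/-- `p`-convexity. The vector `y` below is `(∑ |x_j|^p)^{1/p}`; it exists by `exists_pSum` and is
unique because `coord` is injective. -/
def IsPConvex (S : BanachSeqSpace X) (p : ℝ) : Prop :=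
  ∃ C : ℝ, 1 ≤ C ∧ ∀ (m : ℕ) (x : Fin m → X) (y : X),
    (∀ n, S.coord y n = (∑ j, |S.coord (x j) n| ^ p) ^ (1 / p)) →
      ‖y‖ ≤ C * (∑ j, ‖x j‖ ^ p) ^ (1 / p)

/-- `q`-concavity. The vector `y` below is `(∑ |x_j|^q)^{1/q}`; it exists by `exists_pSum` and is
unique because `coord` is injective. -/
def IsQConcave (S : BanachSeqSpace X) (q : ℝ) : Prop :=
  ∃ C : ℝ, 1 ≤ C ∧ ∀ (m : ℕ) (x : Fin m → X) (y : X),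
    (∀ n, S.coord y n = (∑ j, |S.coord (x j) n| ^ q) ^ (1 / q)) →
      (∑ j, ‖x j‖ ^ q) ^ (1 / q) ≤ C * ‖y‖

/-- `‖ξ‖_inf = inf_σ ‖S_σ ξ‖_X` for `ξ` in `c₀₀`. -/
noncomputable def infNorm (S : BanachSeqSpace X) (ξ : C00) : ℝ :=
  ⨅ σ : Equiv.Perm ℕ+, ‖S.ofC00 (permC00 σ ξ)‖

/-- The norm of `X*` as a space of sequences: a functional `φ` is identified with the sequence
`(φ (e n))`, and a sequence that represents no bounded functional gets the value `∞`. If `c₀₀` is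
dense in `X`, as is the case when `X` is `q`-concave with `q < ∞`, then at most one `φ` represents
`η`, and the value is the norm of this `φ`. -/
noncomputable def dualENorm (S : BanachSeqSpace X) (η : ℕ+ → ℝ) : ENNReal :=
  ⨅ (φ : StrongDual ℝ X) (_ : ∀ n, φ (S.e n) = η n), ‖φ‖ₑ

/-- `‖η‖_sup = sup_σ ‖S_σ η‖_{X*}`, with values in `[0, ∞]`. -/
noncomputable def supENorm (S : BanachSeqSpace X) (η : ℕ+ → ℝ) : ENNReal :=
  ⨆ σ : Equiv.Perm ℕ+, S.dualENorm (fun n => η (σ n))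

/-- The space `X*_sup` of all sequences `η` with `‖η‖_sup < ∞`. -/
def supDual (S : BanachSeqSpace X) : Set (ℕ+ → ℝ) := {η | S.supENorm η < ⊤}

/-- The dual of `X_inf`: the linear functionals on `c₀₀` that are bounded with respect to
`‖·‖_inf`. -/
def infDual (S : BanachSeqSpace X) : Set (C00 →ₗ[ℝ] ℝ) :=
  {f | ∃ M : ℝ, ∀ ξ, |f ξ| ≤ M * S.infNorm ξ}

/-- The norm of a functional in the dual of `X_inf`. -/
noncomputable def infDualNorm (S : BanachSeqSpace X) (f : C00 →ₗ[ℝ] ℝ) : ℝ :=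
  sInf {M : ℝ | 0 ≤ M ∧ ∀ ξ, |f ξ| ≤ M * S.infNorm ξ}

end BanachSeqSpace

/-- The pairing functional `ξ ↦ ∑ ξ_n η_n` on `c₀₀`, which depends linearly on `η`. -/
noncomputable def seqPairing : (ℕ+ → ℝ) →ₗ[ℝ] (C00 →ₗ[ℝ] ℝ) :=
  (Finsupp.llift ℝ ℝ ℝ ℕ+).toLinearMap

theorem seqPairing_apply (η : ℕ+ → ℝ) (ξ : C00) : seqPairing η ξ = ξ.sum fun n c => c * η n := by
  simp [seqPairing]

/-- Quasi-norms on a real vector space. -/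
structure IsQuasiNorm {V : Type*} [AddCommGroup V] [Module ℝ V] (ν : V → ℝ) : Prop where
  nonneg : ∀ v, 0 ≤ ν v
  eq_zero_iff : ∀ v, ν v = 0 ↔ v = 0
  smul : ∀ (c : ℝ) v, ν (c • v) = |c| * ν v
  triangle : ∃ K : ℝ, ∀ v w, ν (v + w) ≤ K * (ν v + ν w)

/-- `ν` is equivalent to a norm. -/
def IsEquivalentToNorm {V : Type*} [AddCommGroup V] [Module ℝ V] (ν : V → ℝ) : Prop :=
  ∃ N : Seminorm ℝ V, (∀ v, N v = 0 → v = 0) ∧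
    ∃ c d : ℝ, 0 < c ∧ 0 < d ∧ ∀ v, c * N v ≤ ν v ∧ ν v ≤ d * N v

/-! The duality is formal: a bound by an infimum over permutations is a bound for every permutation,
and Hahn–Banach passes from `C00` to `X` (`supENorm_le_ofReal_iff`). The substance is that convex
combinations of vectors of the unit ball stay bounded (`exists_infNorm_sum_le`); the gauge of the
convex hull of the ball is then an equivalent norm.

Two estimates carry this. Moving k disjoint pieces into the residue classes mod k costs k^a and
p-convexity costs k^(1/p), so k pieces of norm at most 1 form a vector of norm O(k^b), b = a + 1/p <
1 (`infNorm_le_of_partition`). By q-concavity, a random set that contains each point with small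
probability has a realisation carrying only a small part of v (`exists_infNorm_filter_le`).

Let u = ∑ t_j x_j and draw j with probability t_j. Each n has a level s such that |x_j n| ≥ B^s |u
n| / 2 with probability at least (2B)^(-(s+1)). On level s, a multiple of (2B)^s independent draws,
scaled by 2/B^s, dominate u outside a bad set that can be absorbed (`infNorm_le_of_sample`). So
level s has norm O(((2B)^b / B)^s), and as b < 1 a large B makes the levels summable. -/

/-! ### Rearrangements and elementary properties of the quasi-norm -/

theorem Equiv.Perm.exists_apply_eq_of_injOn {α : Type*} (s : Finset α) (g : α → α)
    (hg : Set.InjOn g s) : ∃ τ : Equiv.Perm α, ∀ n ∈ s, τ (g n) = n := by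
  classical
  have h := Equiv.Perm.isMultiplyPretransitive α s.card
  let x : Fin s.card ↪ α := s.equivFin.symm.toEmbedding.trans (Function.Embedding.subtype _)
  let y : Fin s.card ↪ α := ⟨fun i => g (x i), fun i j hij =>
    x.injective (hg (s.equivFin.symm i).2 (s.equivFin.symm j).2 hij)⟩
  obtain ⟨τ, hτ⟩ := h.exists_smul_eq y x
  refine ⟨τ, fun n hn => ?_⟩
  have := DFunLike.congr_fun hτ (s.equivFin ⟨n, hn⟩)
  simpa [x, y] using this

namespace BanachSeqSpace

variable {X : Type*} [NormedAddCommGroup X] [NormedSpace ℝ X]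

theorem norm_le_norm_of_abs_coord_le (S : BanachSeqSpace X) {x y : X}
    (h : ∀ n, |S.coord x n| ≤ |S.coord y n|) : ‖x‖ ≤ ‖y‖ := by
  obtain ⟨z, hz, hzy⟩ := S.solid y (S.coord x) h
  rwa [← S.coord_injective hz]

theorem infNorm_le_norm (S : BanachSeqSpace X) (ξ : C00) (σ : Equiv.Perm ℕ+) :
    S.infNorm ξ ≤ ‖S.ofC00 (permC00 σ ξ)‖ :=
  ciInf_le ⟨0, by rintro _ ⟨τ, rfl⟩; exact norm_nonneg _⟩ σ

theorem infNorm_nonneg (S : BanachSeqSpace X) (ξ : C00) : 0 ≤ S.infNorm ξ :=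
  le_ciInf fun _ => norm_nonneg _

theorem infNorm_smul (S : BanachSeqSpace X) (c : ℝ) (ξ : C00) :
    S.infNorm (c • ξ) = |c| * S.infNorm ξ := by
  simp only [infNorm, map_smul, norm_smul, Real.norm_eq_abs]
  exact (Real.mul_iInf_of_nonneg (abs_nonneg c) _).symm

/-- The quasi-norm is at most the norm of any vector that dominates a rearrangement. -/
theorem infNorm_le_of_injOn (S : BanachSeqSpace X) (v : C00) (y : X) (g : ℕ+ → ℕ+)
    (hg : Set.InjOn g v.support) (h : ∀ n ∈ v.support, |v n| ≤ |S.coord y (g n)|) :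
    S.infNorm v ≤ ‖y‖ := by
  obtain ⟨τ, hτ⟩ := Equiv.Perm.exists_apply_eq_of_injOn v.support g hg
  refine (S.infNorm_le_norm v τ).trans (S.norm_le_norm_of_abs_coord_le fun m => ?_)
  rw [coord_ofC00, permC00_apply]
  by_cases hm : τ m ∈ v.support
  · have : g (τ m) = m := τ.injective (hτ _ hm)
    simpa [this] using h _ hm
  · simp [Finsupp.notMem_support_iff.1 hm]

theorem infNorm_mono (S : BanachSeqSpace X) {v w : C00} (h : ∀ n, |v n| ≤ |w n|) :
    S.infNorm v ≤ S.infNorm w := by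
  refine le_ciInf fun σ => S.infNorm_le_of_injOn v _ σ.symm σ.symm.injective.injOn fun n _ => ?_
  simpa [coord_ofC00, permC00_apply] using h n

/-- Every rearrangement keeps the entry `ξ n` somewhere, and each unit vector has norm at least `δ`.
-/
theorem infNorm_eq_zero_iff (S : BanachSeqSpace X) (hunit : ∃ δ : ℝ, 0 < δ ∧ ∀ n, δ ≤ ‖S.e n‖)
    (ξ : C00) : S.infNorm ξ = 0 ↔ ξ = 0 := by
  refine ⟨fun h => ?_, fun h => ?_⟩
  · obtain ⟨δ, hδ, he⟩ := hunit
    ext n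
    have key : |ξ n| * δ ≤ S.infNorm ξ := le_ciInf fun σ => by
      calc |ξ n| * δ ≤ |ξ n| * ‖S.e (σ.symm n)‖ := by gcongr; exact he _
        _ = ‖ξ n • S.e (σ.symm n)‖ := by rw [norm_smul, Real.norm_eq_abs]
        _ ≤ _ := S.norm_le_norm_of_abs_coord_le fun m => by
          rw [map_smul, S.coord_e, coord_ofC00, permC00_apply]
          by_cases hm : m = σ.symm n
          · simp [hm]
          · simp [hm]
    have : |ξ n| ≤ 0 := by nlinarith [abs_nonneg (ξ n)]
    simpa using this
  · have := S.infNorm_smul 0 0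
    simpa [h] using this

theorem spreadIndex_inj {k : ℕ+} {i j : ℕ} (hi : i < k) (hj : j < k) {m n : ℕ+}
    (h : spreadIndex k i m = spreadIndex k j n) : i = j ∧ m = n := by
  have h' : (k : ℕ) * m + i = k * n + j := congrArg PNat.val h
  have hij : i = j := by
    have := congrArg (· % (k : ℕ)) h'
    simpa [Nat.mul_add_mod, Nat.mod_eq_of_lt hi, Nat.mod_eq_of_lt hj] using this
  subst hij
  exact ⟨rfl, PNat.coe_injective (Nat.eq_of_mul_eq_mul_left k.pos (Nat.add_right_cancel h'))⟩

theorem spread_apply (k : ℕ+) {j : ℕ} (hj : j < k) (ξ : C00) (n : ℕ+) :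
    spread k j ξ (spreadIndex k j n) = ξ n := by
  rw [spread, Finsupp.lmapDomain_apply]
  exact Finsupp.mapDomain_apply (fun _ _ h => (spreadIndex_inj hj hj h).2) ξ n

/-! ### Disjoint pieces and p-convexity; random restrictions and q-concavity -/

open Classical in
/-- A vector that splits into `k` disjoint parts of norm at most `M` has norm at most a constant
times `k ^ (a + 1 / p) * M`. -/
theorem infNorm_le_of_partition (S : BanachSeqSpace X) {p : ℝ} (hp : 1 < p)
    (hconvex : S.IsPConvex p) {C a : ℝ}
    (hL : ∀ (k : ℕ+) (j : ℕ), j < k → ∀ ξ : C00,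
      ‖S.ofC00 (spread k j ξ)‖ ≤ C * (k : ℝ) ^ a * ‖S.ofC00 ξ‖) :
    ∃ D : ℝ, 1 ≤ D ∧ ∀ (k : ℕ) (v : C00) (π : ℕ+ → Fin k) (M : ℝ),
      (∀ j, S.infNorm (v.filter fun n => π n = j) ≤ M) →
        S.infNorm v ≤ D * (k : ℝ) ^ (a + p⁻¹) * M := by
  obtain ⟨K, hK, hconv⟩ := hconvex
  have hp0 : 0 < p := by linarith
  refine ⟨K * max C 1, by nlinarith [le_max_right C 1], fun k v π M hM => ?_⟩
  have hk : 0 < k := (Nat.zero_le _).trans_lt (π 1).2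
  have hk' : (0 : ℝ) < k := Nat.cast_pos.2 hk
  have hM0 : 0 ≤ M := (S.infNorm_nonneg _).trans (hM (π 1))
  set E := K * max C 1 * (k : ℝ) ^ (a + p⁻¹) with hE
  have hE0 : 0 ≤ E := by positivity
  -- The infimum over permutations need not be attained, hence the slack `ε`.
  suffices H : ∀ ε > 0, S.infNorm v ≤ E * (M + ε) by
    refine le_of_forall_pos_le_add fun ε hε => ?_
    have h1 := H (ε / (E + 1)) (by positivity)
    have h2 : E * (ε / (E + 1)) ≤ ε := by
      rw [mul_div_assoc', div_le_iff₀ (by positivity)]; nlinarith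
    linarith
  intro ε hε
  have h : ∀ j, ∃ σ : Equiv.Perm ℕ+,
      ‖S.ofC00 (permC00 σ (v.filter fun n => π n = j))‖ < M + ε := fun j =>
    exists_lt_of_ciInf_lt ((hM j).trans_lt (by linarith))
  choose σ hσ using h
  -- Each piece gets its own nearly optimal permutation; the spreads then make the pieces disjoint
  -- again, so their p-sum dominates a rearrangement of `v`.
  let x : Fin k → X := fun j =>
    S.ofC00 (spread ⟨k, hk⟩ j (permC00 (σ j) (v.filter fun n => π n = j)))
  obtain ⟨y, hy⟩ := S.exists_pSum hp.le x
  have hx : ∀ j, ‖x j‖ ≤ max C 1 * (k : ℝ) ^ a * (M + ε) := fun j => by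
    refine (hL ⟨k, hk⟩ j j.2 _).trans ?_
    have := (hσ j).le
    rw [PNat.mk_coe]
    gcongr
    exact le_max_left _ _
  have hvy : S.infNorm v ≤ ‖y‖ := by
    refine S.infNorm_le_of_injOn v y
      (fun n => spreadIndex ⟨k, hk⟩ (π n) ((σ (π n)).symm n)) (fun m _ n _ hmn => ?_)
      fun n _ => ?_
    · obtain ⟨h1, h2⟩ := spreadIndex_inj (π m).2 (π n).2 hmn
      rw [Fin.ext h1] at h2
      exact (σ (π n)).symm.injective h2
    · have hxn : S.coord (x (π n)) (spreadIndex ⟨k, hk⟩ (π n) ((σ (π n)).symm n)) = v n := by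
        simp only [x, coord_ofC00]
        rw [spread_apply ⟨k, hk⟩ (π n).2, permC00_apply]
        simp
      rw [hy, abs_of_nonneg (Real.rpow_nonneg
        (Finset.sum_nonneg fun j _ => Real.rpow_nonneg (abs_nonneg _) _) _)]
      calc |v n| = (|v n| ^ p) ^ (1 / p) := by
            rw [← Real.rpow_mul (abs_nonneg _), mul_one_div_cancel hp0.ne', Real.rpow_one]
        _ ≤ _ := by
            refine Real.rpow_le_rpow (by positivity) ?_ (by positivity)
            rw [← hxn]
            exact Finset.single_le_sum
              (f := fun j => |S.coord (x j) (spreadIndex ⟨k, hk⟩ (π n) ((σ (π n)).symm n))| ^ p)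
              (fun j _ => Real.rpow_nonneg (abs_nonneg _) _) (Finset.mem_univ (π n))
  refine hvy.trans ((hconv k x y hy).trans ?_)
  have hB : 0 ≤ max C 1 * (k : ℝ) ^ a * (M + ε) := by positivity
  calc K * (∑ j, ‖x j‖ ^ p) ^ (1 / p)
      ≤ K * (∑ _j : Fin k, (max C 1 * (k : ℝ) ^ a * (M + ε)) ^ p) ^ (1 / p) := by
        gcongr with j
        exact hx j
    _ = K * ((k : ℝ) ^ p⁻¹ * (max C 1 * (k : ℝ) ^ a * (M + ε))) := by
        rw [Finset.sum_const, Finset.card_univ, Fintype.card_fin, nsmul_eq_mul,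
          Real.mul_rpow hk'.le (by positivity), ← Real.rpow_mul hB, mul_one_div_cancel hp0.ne',
          Real.rpow_one, one_div]
    _ = E * (M + ε) := by
        rw [hE, Real.rpow_add hk']; ring

open Classical in
/-- If every point belongs to few of the sets `B i`, then the restriction of `v` to some `B i` is
small. -/
theorem exists_infNorm_filter_le (S : BanachSeqSpace X) {q : ℝ} (hq : 1 < q)
    (hconcave : S.IsQConcave q) {γ : ℝ} (hγ : 0 < γ) :
    ∃ ε : ℝ, 0 < ε ∧ ∀ (ι : Type) [Fintype ι] (w : ι → ℝ) (B : ι → Set ℕ+) (v : C00),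
      (∀ i, 0 ≤ w i) → ∑ i, w i = 1 → (∀ n, ∑ i, w i * (B i).indicator 1 n ≤ ε) →
        ∃ i, S.infNorm (v.filter (· ∈ B i)) ≤ γ * S.infNorm v := by
  obtain ⟨K, hK, hconc⟩ := hconcave
  have hq0 : 0 < q := by linarith
  have hK0 : 0 < K := by linarith
  -- The factor `K` cancels the concavity constant; the factor 2 makes the final inequality
  -- contradictory.
  refine ⟨(γ / (2 * K)) ^ q, by positivity, fun ι _ w B v hw hw1 hB => ?_⟩
  by_contra! hcon
  have hle : ∀ σ : Equiv.Perm ℕ+, γ * S.infNorm v ≤ γ / 2 * ‖S.ofC00 (permC00 σ v)‖ := by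
    intro σ
    let E := (Fintype.equivFin ι).symm
    -- Weights to the power `1 / q` turn the q-sum into an average: its value at `n` is `|v (σ n)|`
    -- times the q-th root of the probability of `σ n`.
    let x : Fin (Fintype.card ι) → X := fun i =>
      (w (E i) ^ (1 / q)) • S.ofC00 (permC00 σ (v.filter (· ∈ B (E i))))
    obtain ⟨y, hy⟩ := S.exists_pSum hq.le x
    have hyv : ‖y‖ ≤ γ / (2 * K) * ‖S.ofC00 (permC00 σ v)‖ := by
      rw [← abs_of_pos (by positivity : 0 < γ / (2 * K)), ← Real.norm_eq_abs, ← norm_smul]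
      refine S.norm_le_norm_of_abs_coord_le fun n => ?_
      have hterm : ∀ i, |S.coord (x i) n| ^ q
          = (w (E i) * (B (E i)).indicator 1 (σ n)) * |v (σ n)| ^ q := fun i => by
        simp only [x, map_smul, Pi.smul_apply, coord_ofC00, permC00_apply, smul_eq_mul, abs_mul]
        rw [abs_of_nonneg (Real.rpow_nonneg (hw _) _), Real.mul_rpow
          (Real.rpow_nonneg (hw _) _) (abs_nonneg _), ← Real.rpow_mul (hw _),
          one_div_mul_cancel hq0.ne', Real.rpow_one]
        by_cases h : σ n ∈ B (E i)
        · simp [h]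
        · simp [h, Real.zero_rpow hq0.ne']
      rw [hy, map_smul, Pi.smul_apply, coord_ofC00, permC00_apply, smul_eq_mul, abs_mul]
      simp only [hterm]
      rw [← Finset.sum_mul, E.sum_comp (fun i => w i * (B i).indicator 1 (σ n)),
        abs_of_pos (by positivity : 0 < γ / (2 * K))]
      have h0 : 0 ≤ ∑ i, w i * (B i).indicator 1 (σ n) :=
        Finset.sum_nonneg fun i _ => mul_nonneg (hw i) (Set.indicator_nonneg (by simp) _)
      rw [abs_of_nonneg (by positivity)]
      calc ((∑ i, w i * (B i).indicator 1 (σ n)) * |v (σ n)| ^ q) ^ (1 / q)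
          ≤ ((γ / (2 * K)) ^ q * |v (σ n)| ^ q) ^ (1 / q) := by gcongr; exact hB _
        _ = _ := by
          rw [← Real.mul_rpow (by positivity) (abs_nonneg _),
            ← Real.rpow_mul (by positivity), mul_one_div_cancel hq0.ne', Real.rpow_one]
    have hν := S.infNorm_nonneg v
    have hlow : γ * S.infNorm v ≤ (∑ i, ‖x i‖ ^ q) ^ (1 / q) := by
      have h1 : (γ * S.infNorm v) ^ q ≤ ∑ i, ‖x i‖ ^ q := by
        calc (γ * S.infNorm v) ^ q = ∑ i, w (E i) * (γ * S.infNorm v) ^ q := by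
              rw [← Finset.sum_mul, E.sum_comp w, hw1, one_mul]
          _ ≤ ∑ i, ‖x i‖ ^ q := by
              refine Finset.sum_le_sum fun i _ => ?_
              simp only [x]
              rw [norm_smul, Real.norm_of_nonneg (Real.rpow_nonneg (hw _) _),
                Real.mul_rpow (Real.rpow_nonneg (hw _) _) (norm_nonneg _),
                ← Real.rpow_mul (hw _), one_div_mul_cancel hq0.ne', Real.rpow_one]
              refine mul_le_mul_of_nonneg_left (Real.rpow_le_rpow (by positivity)
                ((hcon (E i)).le.trans (S.infNorm_le_norm _ σ)) hq0.le) (hw _)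
      calc γ * S.infNorm v = ((γ * S.infNorm v) ^ q) ^ (1 / q) := by
            rw [← Real.rpow_mul (by positivity), mul_one_div_cancel hq0.ne', Real.rpow_one]
        _ ≤ _ := Real.rpow_le_rpow (by positivity) h1 (by positivity)
    refine hlow.trans ((hconc _ x y hy).trans ?_)
    calc K * ‖y‖ ≤ K * (γ / (2 * K) * ‖S.ofC00 (permC00 σ v)‖) := by gcongr
      _ = _ := by field_simp
  have hfin : γ * S.infNorm v ≤ γ / 2 * S.infNorm v := by
    have := le_ciInf hle
    rwa [← Real.mul_iInf_of_nonneg (by positivity)] at this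
  have hne : Nonempty ι := by
    by_contra h
    rw [not_nonempty_iff] at h
    simp at hw1
  obtain ⟨i⟩ := hne
  have hmono : S.infNorm (v.filter (· ∈ B i)) ≤ S.infNorm v := S.infNorm_mono fun n => by
    by_cases h : n ∈ B i <;> simp [h]
  -- The strict inequality in `hcon` fails even in this degenerate case, by monotonicity.
  have h0 : S.infNorm v = 0 := by nlinarith [S.infNorm_nonneg v]
  have := hcon i
  rw [h0] at this hmono
  linarith

/-! ### Duality -/

theorem seqPairing_comp_perm (η : ℕ+ → ℝ) (σ : Equiv.Perm ℕ+) (ξ : C00) :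
    seqPairing (fun n => η (σ n)) (permC00 σ ξ) = seqPairing η ξ := by
  induction ξ using Finsupp.induction_linear with
  | zero => simp
  | add f g hf hg => simp only [map_add, hf, hg]
  | single n c => simp [permC00, seqPairing_apply]

theorem apply_ofC00 (S : BanachSeqSpace X) (φ : StrongDual ℝ X) {ζ : ℕ+ → ℝ}
    (h : ∀ n, φ (S.e n) = ζ n) (ξ : C00) : φ (S.ofC00 ξ) = seqPairing ζ ξ := by
  induction ξ using Finsupp.induction_linear with
  | zero => simp
  | add f g hf hg => simp only [map_add, hf, hg]
  | single n c => simp [ofC00, seqPairing_apply, h]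

theorem ofC00_injective (S : BanachSeqSpace X) : Function.Injective S.ofC00 := fun x y h => by
  have := congrArg S.coord h
  rw [coord_ofC00, coord_ofC00] at this
  exact DFunLike.coe_injective this

/-- By Hahn–Banach a functional bounded on the image of `C00` extends to `X` with the same norm, so
no density of `C00` is needed. -/
theorem dualENorm_le_ofReal_iff (S : BanachSeqSpace X) (ζ : ℕ+ → ℝ) {M : ℝ} (hM : 0 ≤ M) :
    S.dualENorm ζ ≤ ENNReal.ofReal M ↔ ∀ ξ, |seqPairing ζ ξ| ≤ M * ‖S.ofC00 ξ‖ := by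
  refine ⟨fun h ξ => ?_, fun h => ?_⟩
  · suffices H : ∀ ε > 0, |seqPairing ζ ξ| ≤ (M + ε) * ‖S.ofC00 ξ‖ by
      refine le_of_forall_pos_le_add fun ε hε => ?_
      have h1 := H (ε / (‖S.ofC00 ξ‖ + 1)) (by positivity)
      have h2 : ε / (‖S.ofC00 ξ‖ + 1) * ‖S.ofC00 ξ‖ ≤ ε := by
        rw [div_mul_eq_mul_div, div_le_iff₀ (by positivity)]
        nlinarith
      linarith
    intro ε hε
    have h1 : S.dualENorm ζ < ENNReal.ofReal (M + ε) :=
      h.trans_lt ((ENNReal.ofReal_lt_ofReal_iff (by linarith)).2 (by linarith))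
    simp only [dualENorm, iInf_lt_iff] at h1
    obtain ⟨φ, hφ, hlt⟩ := h1
    rw [← ofReal_norm, ENNReal.ofReal_lt_ofReal_iff (by linarith)] at hlt
    rw [← S.apply_ofC00 φ hφ, ← Real.norm_eq_abs]
    exact φ.le_of_opNorm_le hlt.le _
  · let T := LinearEquiv.ofInjective S.ofC00 S.ofC00_injective
    let f : StrongDual ℝ (LinearMap.range S.ofC00) :=
      LinearMap.mkContinuous ((seqPairing ζ).comp T.symm.toLinearMap) M fun x => by
        obtain ⟨ξ, rfl⟩ := T.surjective x
        simpa [T] using h ξ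
    obtain ⟨φ, hφ, hnorm⟩ := exists_extension_norm_eq _ f
    refine (iInf₂_le φ fun n => ?_).trans (?_ : ‖φ‖ₑ ≤ _)
    · have h1 := hφ (T (Finsupp.single n 1))
      have h2 : f (T (Finsupp.single n 1)) = ζ n := by
        change seqPairing ζ (T.symm (T (Finsupp.single n 1))) = ζ n
        simp [seqPairing_apply]
      have h3 : (T (Finsupp.single n 1) : X) = S.e n := by
        change S.ofC00 (Finsupp.single n 1) = S.e n
        simp [ofC00]
      rw [← h3, h1, h2]
    · rw [← ofReal_norm]
      refine ENNReal.ofReal_le_ofReal ?_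
      rw [hnorm]
      exact LinearMap.mkContinuous_norm_le _ hM _

/-- The pairing is invariant under permuting both arguments, so the bounds for all `σ` combine into
one bound by the infimum. -/
theorem supENorm_le_ofReal_iff (S : BanachSeqSpace X) (η : ℕ+ → ℝ) {M : ℝ} (hM : 0 ≤ M) :
    S.supENorm η ≤ ENNReal.ofReal M ↔ ∀ ξ, |seqPairing η ξ| ≤ M * S.infNorm ξ := by
  simp only [supENorm, iSup_le_iff, S.dualENorm_le_ofReal_iff _ hM]
  refine ⟨fun h ξ => ?_, fun h σ ξ => ?_⟩
  · rw [infNorm, Real.mul_iInf_of_nonneg hM]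
    refine le_ciInf fun σ => ?_
    rw [← seqPairing_comp_perm η σ]
    exact h σ _
  · have h1 : permC00 σ (permC00 σ.symm ξ) = ξ := by ext n; simp [permC00_apply]
    have h2 := seqPairing_comp_perm η σ (permC00 σ.symm ξ)
    have h3 := S.infNorm_le_norm (permC00 σ.symm ξ) σ
    rw [h1] at h2 h3
    rw [h2]
    exact (h _).trans (by gcongr)

theorem bijOn_seqPairing (S : BanachSeqSpace X) : Set.BijOn seqPairing S.supDual S.infDual := by
  refine ⟨fun η hη => ?_, (Finsupp.llift ℝ ℝ ℝ ℕ+).injective.injOn, fun f hf => ?_⟩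
  · refine ⟨(S.supENorm η).toReal, (S.supENorm_le_ofReal_iff η ENNReal.toReal_nonneg).1 ?_⟩
    rw [ENNReal.ofReal_toReal (ne_of_lt hη)]
  · obtain ⟨M, hM⟩ := hf
    obtain ⟨η, hη⟩ := (Finsupp.llift ℝ ℝ ℝ ℕ+).surjective f
    have hη' : seqPairing η = f := hη
    refine ⟨η, ?_, hη'⟩
    refine lt_of_le_of_lt ((S.supENorm_le_ofReal_iff η (le_max_right M 0)).2 fun ξ => ?_)
      ENNReal.ofReal_lt_top
    rw [hη']
    exact (hM ξ).trans (mul_le_mul_of_nonneg_right (le_max_left _ _) (S.infNorm_nonneg ξ))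

/-- The admissible constants form a closed half-line starting at the sup norm. -/
theorem ofReal_infDualNorm_seqPairing (S : BanachSeqSpace X) {η : ℕ+ → ℝ} (hη : η ∈ S.supDual) :
    ENNReal.ofReal (S.infDualNorm (seqPairing η)) = S.supENorm η := by
  have hset : {M : ℝ | 0 ≤ M ∧ ∀ ξ, |seqPairing η ξ| ≤ M * S.infNorm ξ}
      = Set.Ici (S.supENorm η).toReal := by
    ext M
    refine ⟨fun h => ?_, fun h => ?_⟩
    · exact ENNReal.toReal_le_of_le_ofReal h.1 ((S.supENorm_le_ofReal_iff η h.1).2 h.2)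
    · have hM : 0 ≤ M := ENNReal.toReal_nonneg.trans h
      refine ⟨hM, (S.supENorm_le_ofReal_iff η hM).1 ?_⟩
      exact (ENNReal.le_ofReal_iff_toReal_le (ne_of_lt hη) hM).2 h
  rw [infDualNorm, hset, csInf_Ici, ENNReal.ofReal_toReal (ne_of_lt hη)]

end BanachSeqSpace

/-! ### Level selection for averages -/

/-- If `z` is at least `c / 2`, the last `s` with `B ^ s * (c / 2) ≤ z` already contributes more
than `z`. The level sets are written as `c ≤ R * y` with `R = 2 / B ^ s`, the form used in sampling.
-/
theorem le_add_sum_indicator_mul_pow {B c z : ℝ} (hc : 0 < c) (hB : 0 < B) (S : ℕ)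
    (hz : z < B ^ S * (c / 2)) :
    z ≤ c / 2 + ∑ s ∈ Finset.range S,
      {y : ℝ | c ≤ 2 / B ^ s * y}.indicator 1 z * (B ^ (s + 1) * (c / 2)) := by
  have hterm : ∀ s, 0 ≤ {y : ℝ | c ≤ 2 / B ^ s * y}.indicator (1 : ℝ → ℝ) z
      * (B ^ (s + 1) * (c / 2)) := fun s =>
    mul_nonneg (Set.indicator_nonneg (by simp) _) (by positivity)
  induction S with
  | zero => simpa using hz.le
  | succ S ih =>
    rw [Finset.sum_range_succ]
    by_cases h : z < B ^ S * (c / 2)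
    · linarith [ih h, hterm S]
    · have hmem : z ∈ {y : ℝ | c ≤ 2 / B ^ S * y} := by
        have h1 : B ^ S * (c / 2) ≤ z := not_lt.1 h
        calc c = 2 / B ^ S * (B ^ S * (c / 2)) := by field_simp
          _ ≤ 2 / B ^ S * z := by gcongr
      have hsum : 0 ≤ ∑ s ∈ Finset.range S,
          {y : ℝ | c ≤ 2 / B ^ s * y}.indicator (1 : ℝ → ℝ) z * (B ^ (s + 1) * (c / 2)) :=
        Finset.sum_nonneg fun s _ => hterm s
      rw [Set.indicator_of_mem hmem, Pi.one_apply, one_mul]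
      linarith

/-- If an average of nonnegative numbers is at least `c`, then for some `s` the numbers of size at
least `B ^ s * c / 2` have weight at least `(1 / (2 * B)) ^ (s + 1)`. -/
theorem exists_pow_le_sum_indicator {ι : Type*} [Fintype ι] {B c : ℝ} (hB : 1 < B) (hc : 0 < c)
    (t z : ι → ℝ) (ht : ∀ j, 0 ≤ t j) (ht1 : ∑ j, t j = 1) (hz : ∀ j, 0 ≤ z j)
    (h : c ≤ ∑ j, t j * z j) :
    ∃ s : ℕ, (1 / (2 * B)) ^ (s + 1)
      ≤ ∑ j, t j * {y : ℝ | c ≤ 2 / B ^ s * y}.indicator 1 (z j) := by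
  -- Otherwise layer `s` contributes at most `2 ^ (-(s + 1)) * c / 2`; finitely many layers total
  -- less than `c / 2`, so the average is below `c`.
  by_contra! hcon
  have hB0 : 0 < B := by linarith
  obtain ⟨S, hS⟩ := pow_unbounded_of_one_lt ((∑ j, z j) / (c / 2)) hB
  rw [div_lt_iff₀ (by positivity)] at hS
  have hzS : ∀ j, z j < B ^ S * (c / 2) := fun j =>
    (Finset.single_le_sum (fun i _ => hz i) (Finset.mem_univ j)).trans_lt hS
  have h1 : ∑ j, t j * z j ≤ c / 2 + ∑ s ∈ Finset.range S,
      (∑ j, t j * {y : ℝ | c ≤ 2 / B ^ s * y}.indicator 1 (z j)) * (B ^ (s + 1) * (c / 2)) := by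
    calc ∑ j, t j * z j ≤ ∑ j, t j * (c / 2 + ∑ s ∈ Finset.range S,
          {y : ℝ | c ≤ 2 / B ^ s * y}.indicator 1 (z j) * (B ^ (s + 1) * (c / 2))) :=
          Finset.sum_le_sum fun j _ => mul_le_mul_of_nonneg_left
            (le_add_sum_indicator_mul_pow hc hB0 S (hzS j)) (ht j)
      _ = _ := by
          simp only [mul_add, Finset.sum_add_distrib]
          rw [← Finset.sum_mul, ht1, one_mul]
          simp only [Finset.mul_sum, Finset.sum_mul]
          rw [Finset.sum_comm]
          simp only [mul_assoc]
  have h2 : ∑ s ∈ Finset.range S,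
      (∑ j, t j * {y : ℝ | c ≤ 2 / B ^ s * y}.indicator 1 (z j)) * (B ^ (s + 1) * (c / 2))
      ≤ ∑ s ∈ Finset.range S, (1 / 2 : ℝ) ^ s * (c / 4) := by
    refine Finset.sum_le_sum fun s _ => ?_
    calc _ ≤ (1 / (2 * B)) ^ (s + 1) * (B ^ (s + 1) * (c / 2)) := by
          gcongr
          exact (hcon s).le
      _ = (1 / (2 * B) * B) ^ (s + 1) * (c / 2) := by rw [mul_pow]; ring
      _ = (1 / 2 : ℝ) ^ s * (c / 4) := by
          rw [show 1 / (2 * B) * B = 1 / 2 by field_simp, pow_succ]; ring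
  rw [← Finset.sum_mul, geom_sum_eq (by norm_num)] at h2
  have h3 : (0 : ℝ) < (1 / 2) ^ S := by positivity
  rw [show (((1 / 2 : ℝ)) ^ S - 1) / (1 / 2 - 1) = 2 * (1 - (1 / 2) ^ S) by ring] at h2
  nlinarith [mul_pos h3 hc]

/-! ### Boundedness of convex combinations -/

namespace BanachSeqSpace

variable {X : Type*} [NormedAddCommGroup X] [NormedSpace ℝ X]

open Classical in
theorem infNorm_le_max_filter (S : BanachSeqSpace X) {D b : ℝ}
    (hpart : ∀ (k : ℕ) (v : C00) (π : ℕ+ → Fin k) (M : ℝ),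
      (∀ j, S.infNorm (v.filter fun n => π n = j) ≤ M) → S.infNorm v ≤ D * (k : ℝ) ^ b * M)
    (v : C00) (P : ℕ+ → Prop) : S.infNorm v
      ≤ D * 2 ^ b * max (S.infNorm (v.filter P)) (S.infNorm (v.filter fun n => ¬ P n)) := by
  refine hpart 2 v (fun n => if P n then 0 else 1) _ fun j => ?_
  fin_cases j
  · refine le_trans (le_of_eq ?_) (le_max_left _ _)
    congr 2
    ext n
    by_cases h : P n <;> simp [h]
  · refine le_trans (le_of_eq ?_) (le_max_right _ _)
    congr 2
    ext n
    by_cases h : P n <;> simp [h]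

open Classical in
/-- If the parts of `v` have geometrically decreasing norms, then the norm of `v` is controlled by
that of the first part. -/
theorem infNorm_le_of_geometric (S : BanachSeqSpace X) {E : ℝ} (hE : 0 ≤ E)
    (htwo : ∀ (v : C00) (P : ℕ+ → Prop), S.infNorm v
      ≤ E * max (S.infNorm (v.filter P)) (S.infNorm (v.filter fun n => ¬ P n)))
    {θ M : ℝ} (hθ : 0 ≤ θ) (hM : 0 ≤ M) (hEθ : E * θ ≤ 1) (v : C00) (π : ℕ+ → ℕ)
    (h : ∀ s, S.infNorm (v.filter fun n => π n = s) ≤ M * θ ^ s) : S.infNorm v ≤ E * M := by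
  have hzero : S.infNorm 0 = 0 := by simpa using S.infNorm_smul 0 0
  -- Induction on the number `d` of remaining levels: since `E * θ ≤ 1`, the bound for the tail
  -- after `s` is at most that for level `s`, so the factor `E` does not accumulate.
  have key : ∀ d s, (∀ n ∈ v.support, π n < s + d) →
      S.infNorm (v.filter fun n => s ≤ π n) ≤ E * (M * θ ^ s) := by
    intro d
    induction d with
    | zero =>
      intro s hs
      have : v.filter (fun n => s ≤ π n) = 0 := by
        rw [Finsupp.filter_eq_zero_iff]
        intro n hn
        by_contra hv
        have := hs n (Finsupp.mem_support_iff.2 hv)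
        omega
      rw [this, hzero]
      positivity
    | succ d ih =>
      intro s hs
      have h1 := ih (s + 1) fun n hn => by have := hs n hn; omega
      refine (htwo _ fun n => π n = s).trans ?_
      refine mul_le_mul_of_nonneg_left (max_le ?_ ?_) hE
      · refine le_trans (S.infNorm_mono fun n => ?_) (h s)
        by_cases hn : π n = s <;> simp [hn]
      · calc _ ≤ S.infNorm (v.filter fun n => s + 1 ≤ π n) := S.infNorm_mono fun n => by
              by_cases hn : π n = s
              · simp [hn]
              · by_cases hn' : s ≤ π n
                · have : s < π n := by omega
                  simp [hn, hn', this]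
                · simp [hn, hn']
          _ ≤ E * (M * θ ^ (s + 1)) := h1
          _ = (E * θ) * (M * θ ^ s) := by ring
          _ ≤ M * θ ^ s := mul_le_of_le_one_left (by positivity) hEθ
  have := key (v.support.sup π + 1) 0 fun n hn => by
    have := Finset.le_sup (f := π) hn
    omega
  have hv : v.filter (fun n => 0 ≤ π n) = v := by ext n; simp
  rwa [hv, pow_zero, mul_one] at this

open Classical in
/-- If at each point of its support `v` is dominated by `N` random vectors of the unit ball with
probability close to one, then `v` is bounded like a maximum of `N` vectors of the unit ball. -/
theorem infNorm_le_of_sample (S : BanachSeqSpace X) {D b E ε : ℝ} (hE : 0 < E)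
    (hpart : ∀ (k : ℕ) (v : C00) (π : ℕ+ → Fin k) (M : ℝ),
      (∀ j, S.infNorm (v.filter fun n => π n = j) ≤ M) → S.infNorm v ≤ D * (k : ℝ) ^ b * M)
    (htwo : ∀ (v : C00) (P : ℕ+ → Prop), S.infNorm v
      ≤ E * max (S.infNorm (v.filter P)) (S.infNorm (v.filter fun n => ¬ P n)))
    (hε0 : 0 < ε)
    (hε : ∀ (ι : Type) [Fintype ι] (w : ι → ℝ) (B : ι → Set ℕ+) (v : C00),
      (∀ i, 0 ≤ w i) → ∑ i, w i = 1 → (∀ n, ∑ i, w i * (B i).indicator 1 n ≤ ε) →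
        ∃ i, S.infNorm (v.filter (· ∈ B i)) ≤ 1 / (2 * E) * S.infNorm v)
    {ι : Type} [Fintype ι] (t : ι → ℝ) (x : ι → C00) (ht : ∀ j, 0 ≤ t j) (ht1 : ∑ j, t j = 1)
    (hx : ∀ j, S.infNorm (x j) ≤ 1) (v : C00) {R : ℝ} (hR : 0 ≤ R) {N : ℕ} (hN : N ≠ 0)
    (hv : ∀ n ∈ v.support,
      (1 - ∑ j, t j * {y : ℝ | |v n| ≤ R * y}.indicator 1 |x j n|) ^ N ≤ ε) :
    S.infNorm v ≤ E * (D * (N : ℝ) ^ b * R) + S.infNorm v / 2 := by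
  -- `G n` collects the draws that fail to dominate at `n`; `bad f` is where all `N` draws fail.
  -- Product weights make the draws independent.
  let G : ℕ+ → Set ι := fun n => {j | ¬ |v n| ≤ R * |x j n|}
  obtain ⟨bad, hmem⟩ : ∃ bad : (Fin N → ι) → Set ℕ+, ∀ f n, n ∈ bad f ↔ ∀ l, f l ∈ G n :=
    ⟨fun f => {n | ∀ l, f l ∈ G n}, fun f n => Iff.rfl⟩
  obtain ⟨f, hf⟩ := hε (Fin N → ι) (fun f => ∏ l, t (f l)) bad v
    (fun f => Finset.prod_nonneg fun l _ => ht _) (by rw [← Fintype.sum_pow, ht1, one_pow])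
    fun n => by
      have h1 : ∀ f : Fin N → ι, (∏ l, t (f l)) * (bad f).indicator 1 n
          = ∏ l, t (f l) * (G n).indicator 1 (f l) := fun f => by
        rw [Finset.prod_mul_distrib]
        congr 1
        by_cases h : n ∈ bad f
        · rw [Set.indicator_of_mem h, Finset.prod_congr rfl fun l _ =>
            Set.indicator_of_mem ((hmem f n).1 h l) _]
          simp
        · obtain ⟨l, hl⟩ := not_forall.1 (mt (hmem f n).2 h)
          rw [Set.indicator_of_notMem h]
          exact (Finset.prod_eq_zero (Finset.mem_univ l) (Set.indicator_of_notMem hl _)).symm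
      simp only [h1]
      refine (Fintype.sum_pow (fun j => t j * (G n).indicator 1 j) N).symm.trans_le ?_
      by_cases hn : n ∈ v.support
      · refine le_of_eq_of_le ?_ (hv n hn)
        congr 1
        rw [eq_sub_iff_add_eq, ← Finset.sum_add_distrib, ← ht1]
        refine Finset.sum_congr rfl fun j _ => ?_
        by_cases h : |v n| ≤ R * |x j n|
        · simp [h, show j ∉ G n from not_not.2 h]
        · simp [h, show j ∈ G n from h]
      -- Off the support every draw dominates 0; `N ≠ 0` is needed since an empty sample would fail
      -- everywhere.
      · have hG : G n = ∅ := by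
          ext j
          have : 0 ≤ R * |x j n| := by positivity
          simp [G, Finsupp.notMem_support_iff.1 hn, this]
        simp [hG, hN, hε0.le]
  have hgood : S.infNorm (v.filter fun n => ¬ n ∈ bad f) ≤ D * (N : ℝ) ^ b * R := by
    have hl : ∀ n, ∃ l, n ∉ bad f → f l ∉ G n := fun n => by
      by_cases h : n ∈ bad f
      · exact ⟨⟨0, Nat.pos_of_ne_zero hN⟩, fun h' => absurd h h'⟩
      · obtain ⟨l, hl⟩ := not_forall.1 (mt (hmem f n).2 h)
        exact ⟨l, fun _ => hl⟩
    choose π hπ using hl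
    refine hpart N _ π R fun l => ?_
    calc _ ≤ S.infNorm (R • x (f l)) := S.infNorm_mono fun n => by
          rw [Finsupp.smul_apply, smul_eq_mul, abs_mul, abs_of_nonneg hR, Finsupp.filter_apply,
            Finsupp.filter_apply]
          have h0 : 0 ≤ R * |x (f l) n| := by positivity
          split_ifs with h1 h2
          · simpa using h0
          · have := hπ n h2
            rw [h1] at this
            exact not_not.1 this
          · simpa using h0
      _ = R * S.infNorm (x (f l)) := by rw [infNorm_smul, abs_of_nonneg hR]
      _ ≤ R := mul_le_of_le_one_right hR (hx _)
  have hbad : E * S.infNorm (v.filter (· ∈ bad f)) ≤ S.infNorm v / 2 := by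
    calc _ ≤ E * (1 / (2 * E) * S.infNorm v) := mul_le_mul_of_nonneg_left hf hE.le
      _ = _ := by field_simp
  refine (htwo v (· ∈ bad f)).trans ?_
  have h1 := mul_le_mul_of_nonneg_left hgood hE.le
  have h2 : 0 ≤ E * S.infNorm (v.filter (· ∈ bad f)) := mul_nonneg hE.le (S.infNorm_nonneg _)
  have h3 : 0 ≤ E * S.infNorm (v.filter fun n => ¬ n ∈ bad f) :=
    mul_nonneg hE.le (S.infNorm_nonneg _)
  rw [mul_max_of_nonneg _ _ hE.le]
  refine max_le ?_ ?_ <;> linarith [S.infNorm_nonneg v]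

/-- The quasi-norm is bounded on convex combinations of vectors of its unit ball. -/
theorem exists_infNorm_sum_le (S : BanachSeqSpace X) {p q : ℝ} (hp : 1 < p) (hq : 1 < q)
    (hconvex : S.IsPConvex p) (hconcave : S.IsQConcave q) {C a : ℝ} (ha : a + p⁻¹ < 1)
    (hL : ∀ (k : ℕ+) (j : ℕ), j < k → ∀ ξ : C00,
      ‖S.ofC00 (spread k j ξ)‖ ≤ C * (k : ℝ) ^ a * ‖S.ofC00 ξ‖) :
    ∃ A : ℝ, 0 < A ∧ ∀ (ι : Type) [Fintype ι] (t : ι → ℝ) (x : ι → C00), (∀ j, 0 ≤ t j) →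
      ∑ j, t j = 1 → (∀ j, S.infNorm (x j) ≤ 1) → S.infNorm (∑ j, t j • x j) ≤ A := by
  classical
  obtain ⟨D, hD, hpart⟩ := S.infNorm_le_of_partition hp hconvex hL
  set b := a + p⁻¹
  set E := D * 2 ^ b with hEdef
  have hD0 : 0 < D := by linarith
  have hE : 0 < E := by positivity
  have htwo := S.infNorm_le_max_filter hpart
  obtain ⟨ε, hε0, hε⟩ := S.exists_infNorm_filter_le hq hconcave
    (by positivity : 0 < 1 / (2 * E))
  obtain ⟨h, hh⟩ : ∃ h : ℕ, h ≠ 0 ∧ Real.exp (-h) ≤ ε := by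
    obtain ⟨h, hh⟩ := exists_nat_ge (-Real.log ε)
    refine ⟨h + 1, by omega, ?_⟩
    rw [← Real.le_log_iff_exp_le hε0]
    push_cast
    linarith
  -- This is where `b < 1` enters: `(2B)^b / B` tends to 0.
  obtain ⟨B, hB1, hB⟩ : ∃ B : ℕ, 1 < B ∧ E * ((2 * B : ℝ) ^ b / B) ≤ 1 := by
    have hlim : Filter.Tendsto (fun B : ℕ => E * 2 ^ b * (B : ℝ) ^ (-(1 - b))) Filter.atTop
        (nhds (E * 2 ^ b * 0)) :=
      ((tendsto_rpow_neg_atTop (by linarith)).comp tendsto_natCast_atTop_atTop).const_mul _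
    rw [mul_zero] at hlim
    obtain ⟨B, hB, hB1⟩ := ((hlim.eventually_le_const one_pos).and
      (Filter.eventually_gt_atTop 1)).exists
    refine ⟨B, hB1, hB.trans_eq' ?_⟩
    have hB0 : (0 : ℝ) < B := by positivity
    rw [Real.mul_rpow (by norm_num) hB0.le, neg_sub, Real.rpow_sub hB0, Real.rpow_one]
    ring
  have hB1' : (1 : ℝ) < B := by exact_mod_cast hB1
  set θ : ℝ := (2 * B : ℝ) ^ b / B with hθ
  -- The sampling bound at level 0, doubled to absorb the bad part.
  set M : ℝ := 2 * (E * (D * ((h : ℝ) ^ b * (2 * B : ℝ) ^ b) * 2)) with hM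
  have hh0 : (0 : ℝ) < h := by have := Nat.pos_of_ne_zero hh.1; positivity
  refine ⟨E * M, by positivity, fun ι _ t x ht ht1 hx => ?_⟩
  set u := ∑ j, t j • x j with hu
  have hsel : ∀ n, ∃ s : ℕ, n ∈ u.support → (1 / (2 * B : ℝ)) ^ (s + 1)
      ≤ ∑ j, t j * {y : ℝ | |u n| ≤ 2 / (B : ℝ) ^ s * y}.indicator 1 |x j n| := fun n => by
    by_cases hn : n ∈ u.support
    · obtain ⟨s, hs⟩ := exists_pow_le_sum_indicator hB1'
        (abs_pos.2 (Finsupp.mem_support_iff.1 hn)) t (fun j => |x j n|) ht ht1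
        (fun j => abs_nonneg _) (by
          rw [hu, Finsupp.finsetSum_apply]
          refine (Finset.abs_sum_le_sum_abs _ _).trans_eq (Finset.sum_congr rfl fun j _ => ?_)
          rw [Finsupp.smul_apply, smul_eq_mul, abs_mul, abs_of_nonneg (ht j)])
      exact ⟨s, fun _ => hs⟩
    · exact ⟨0, fun h => absurd h hn⟩
  choose π hπ using hsel
  refine S.infNorm_le_of_geometric hE.le htwo (by positivity) (by positivity) hB u π fun s => ?_
  -- With this many draws at least `h` successes are expected at each point of level `s`, so all
  -- fail with probability at most `exp (-h) ≤ ε`.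
  have hN : h * (2 * B) ^ (s + 1) ≠ 0 := mul_ne_zero hh.1 (pow_ne_zero _ (by omega))
  have hsample := S.infNorm_le_of_sample hE hpart htwo hε0 hε t x ht ht1 hx
    (u.filter fun n => π n = s) (R := 2 / (B : ℝ) ^ s) (by positivity) hN fun n hn => by
      rw [Finsupp.support_filter, Finset.mem_filter] at hn
      have h1 := hπ n hn.1
      rw [hn.2] at h1
      rw [Finsupp.filter_apply_pos (fun n => π n = s) u hn.2]
      set P := ∑ j, t j * {y : ℝ | |u n| ≤ 2 / (B : ℝ) ^ s * y}.indicator 1 |x j n|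
      have hP : P ≤ 1 := by
        rw [← ht1]
        refine Finset.sum_le_sum fun j _ => mul_le_of_le_one_right (ht j) ?_
        exact Set.indicator_le_self' (by simp) _
      refine le_trans ?_ hh.2
      calc (1 - P) ^ (h * (2 * B) ^ (s + 1)) ≤ Real.exp (-P) ^ (h * (2 * B) ^ (s + 1)) :=
            pow_le_pow_left₀ (by linarith) (Real.one_sub_le_exp_neg P) _
        _ = Real.exp (-(P * (2 * B) ^ (s + 1) * h)) := by
            rw [← Real.exp_nat_mul]; push_cast; congr 1; ring
        _ ≤ Real.exp (-h) := by
            refine Real.exp_le_exp.2 (neg_le_neg (le_mul_of_one_le_left hh0.le ?_))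
            calc (1 : ℝ) = (1 / (2 * B : ℝ)) ^ (s + 1) * (2 * B) ^ (s + 1) := by
                  rw [← mul_pow, one_div_mul_cancel (by positivity), one_pow]
              _ ≤ _ := by gcongr
  have hpow : ((h * (2 * B) ^ (s + 1) : ℕ) : ℝ) ^ b
      = (h : ℝ) ^ b * (2 * B : ℝ) ^ b * ((2 * B : ℝ) ^ b) ^ s := by
    push_cast
    rw [Real.mul_rpow hh0.le (by positivity), ← Real.rpow_natCast, ← Real.rpow_mul (by positivity),
      mul_comm _ b, Real.rpow_mul (by positivity), Real.rpow_natCast]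
    ring
  rw [hpow] at hsample
  have hfin : M * θ ^ s = 2 * (E * (D * ((h : ℝ) ^ b * (2 * B : ℝ) ^ b * ((2 * B : ℝ) ^ b) ^ s)
      * (2 / (B : ℝ) ^ s))) := by
    rw [hM, hθ, div_pow]; ring
  rw [hfin]
  linarith

/-! ### The equivalent norm -/

open scoped Pointwise in
-- The norm is the gauge of the convex hull of the unit ball: the hull contains the ball, and by `h`
-- the quasi-norm is at most `A` on it.
theorem isEquivalentToNorm_infNorm (S : BanachSeqSpace X)
    (hunit : ∃ δ : ℝ, 0 < δ ∧ ∀ n, δ ≤ ‖S.e n‖) {A : ℝ} (hA : 0 < A)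
    (h : ∀ (ι : Type) [Fintype ι] (t : ι → ℝ) (x : ι → C00), (∀ j, 0 ≤ t j) →
      ∑ j, t j = 1 → (∀ j, S.infNorm (x j) ≤ 1) → S.infNorm (∑ j, t j • x j) ≤ A) :
    IsEquivalentToNorm S.infNorm := by
  let U : Set C00 := {x | S.infNorm x ≤ 1}
  have hUbal : Balanced ℝ U := balanced_iff_smul_mem.2 fun r hr x hx => by
    rw [Real.norm_eq_abs] at hr
    change S.infNorm (r • x) ≤ 1
    rw [infNorm_smul]
    exact mul_le_one₀ hr (S.infNorm_nonneg x) hx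
  have hmem : ∀ (x : C00) (r : ℝ), r ≠ 0 → S.infNorm x ≤ |r| → x ∈ r • U := fun x r hr hx => by
    rw [Set.mem_smul_set_iff_inv_smul_mem₀ hr]
    change S.infNorm (r⁻¹ • x) ≤ 1
    rw [infNorm_smul, abs_inv, inv_mul_le_iff₀ (abs_pos.2 hr), mul_one]
    exact hx
  have hUabs : Absorbent ℝ U := fun x =>
    Absorbs.of_norm ⟨S.infNorm x + 1, fun c hc => Set.singleton_subset_iff.2 <| by
      rw [Real.norm_eq_abs] at hc
      exact hmem x c (abs_pos.1 (by linarith [S.infNorm_nonneg x])) (by linarith)⟩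
  have hhull : ∀ x ∈ convexHull ℝ U, S.infNorm x ≤ A := fun x hx => by
    obtain ⟨ι, _, w, z, hw, hw1, hz, rfl⟩ := mem_convexHull_iff_exists_fintype.1 hx
    exact h ι w z hw hw1 hz
  let N : Seminorm ℝ C00 := gaugeSeminorm hUbal.convexHull (convex_convexHull ℝ U)
    (hUabs.mono (subset_convexHull ℝ U))
  have hlow : ∀ v, N v ≤ S.infNorm v := fun v => by
    refine le_of_forall_pos_le_add fun r hr => ?_
    have hr' : 0 < S.infNorm v + r := by linarith [S.infNorm_nonneg v]
    exact gauge_le_of_mem hr'.le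
      (Set.smul_set_mono (subset_convexHull ℝ U) (hmem v _ hr'.ne'
        (by rw [abs_of_pos hr']; linarith)))
  have hup : ∀ v, S.infNorm v ≤ A * N v := fun v => by
    rw [mul_comm, ← div_le_iff₀ hA]
    refine le_of_forall_gt_imp_ge_of_dense fun r hr => ?_
    obtain ⟨s, hs, hsr, y, hy, rfl⟩ :=
      exists_lt_of_gauge_lt (hUabs.mono (subset_convexHull ℝ U)) hr
    rw [div_le_iff₀ hA]
    dsimp only
    rw [infNorm_smul, abs_of_pos hs]
    exact mul_le_mul hsr.le (hhull y hy) (S.infNorm_nonneg y) (hs.trans hsr).le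
  refine ⟨N, fun v hv => ?_, 1, A, one_pos, hA, fun v => ⟨by simpa using hlow v, hup v⟩⟩
  refine (S.infNorm_eq_zero_iff hunit v).1 (le_antisymm ?_ (S.infNorm_nonneg v))
  simpa [hv] using hup v

theorem isQuasiNorm_infNorm (S : BanachSeqSpace X)
    (hunit : ∃ δ : ℝ, 0 < δ ∧ ∀ n, δ ≤ ‖S.e n‖) (h : IsEquivalentToNorm S.infNorm) :
    IsQuasiNorm S.infNorm := by
  refine ⟨S.infNorm_nonneg, S.infNorm_eq_zero_iff hunit, S.infNorm_smul, ?_⟩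
  obtain ⟨N, -, c, d, hc, hd, hN⟩ := h
  refine ⟨d / c, fun v w => ?_⟩
  rw [div_mul_eq_mul_div, le_div_iff₀ hc]
  calc S.infNorm (v + w) * c ≤ d * N (v + w) * c := by gcongr; exact (hN _).2
    _ ≤ d * (N v + N w) * c := by gcongr; exact map_add_le_add N v w
    _ = d * (c * N v + c * N w) := by ring
    _ ≤ _ := by gcongr; exacts [(hN v).1, (hN w).1]

end BanachSeqSpace

theorem mainTheorem4 {X : Type*} [NormedAddCommGroup X] [NormedSpace ℝ X] [CompleteSpace X]
    (S : BanachSeqSpace X) (p q : ℝ) (hp : 1 < p) (hpq : p < q)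
    (hconvex : S.IsPConvex p) (hconcave : S.IsQConcave q)
    (hunit : ∃ δ : ℝ, 0 < δ ∧ ∀ n, δ ≤ ‖S.e n‖)
    (C a : ℝ) (ha : a + p⁻¹ < 1)
    (hL : ∀ (k : ℕ+) (j : ℕ), j < k → ∀ ξ : C00,
      ‖S.ofC00 (spread k j ξ)‖ ≤ C * (k : ℝ) ^ a * ‖S.ofC00 ξ‖) :
    IsQuasiNorm S.infNorm ∧ IsEquivalentToNorm S.infNorm ∧
      Set.BijOn seqPairing S.supDual S.infDual ∧
      ∀ η ∈ S.supDual, ENNReal.ofReal (S.infDualNorm (seqPairing η)) = S.supENorm η := by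
  have hq : 1 < q := hp.trans hpq
  obtain ⟨A, hA, h⟩ := S.exists_infNorm_sum_le hp hq hconvex hconcave ha hL
  have hequiv := S.isEquivalentToNorm_infNorm hunit hA h
  exact ⟨S.isQuasiNorm_infNorm hunit hequiv, hequiv, S.bijOn_seqPairing,
    fun _ => S.ofReal_infDualNorm_seqPairing⟩
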